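/- **Setting.** Let $n$ denote the security parameter; $f:\mathbb N\to\mathbb R$ is negligible if $n^d f(n)\to 0$ for every $d$. A (fixed-length) *symmetric-key quantum encryption scheme* $\Pi=(\mathsf{KeyGen},\mathsf{Enc},\mathsf{Dec})$ draws a uniformly random classical key $k$ from a nonempty finite set $\mathcal K_n$ of bit strings and has, for each key, channels $\mathsf{Enc}_k$ from the plaintext register $M$ to the ciphertext register $C$ and $\mathsf{Dec}_k$ from $C$ to $M\oplus\mathbb C|\bot\rangle$, where keys, $M$ and $C$ have polynomially many (qu)bits, such that $\|\mathsf{Dec}_k\circ\mathsf{Enc}_k-(\mathbb 1_M\oplus 0_\bot)\|_\diamond\le\varepsilon(n)$ for all $k\in\mathcal K_n$ and some negligible $\varepsilon$. (The result holds whether or not the three algorithms are efficient.) Decryption is always followed by the measurement $\{|\bot\rangle\langle\bot|,\mathbb 1-|\bot\rangle\langle\bot|\}$. Fix a representation of encryption by classical randomness: for each key, a register $T$ of qubits, a unitary $V_k:M\otimes T\to C$, an orthonormal basis $(|\psi^{(k,r)}\rangle)_r$ of $T$ and a probability distribution $p_k$ with $\mathsf{Enc}_k(X)=V_k\bigl(X\otimes\sum_r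 p_k(r)\Pi_{k,r}\bigr)V_k^\dagger$, $\Pi_{k,r}=|\psi^{(k,r)}\rangle\langle\psi^{(k,r)}|$. "Encrypting with randomness $r$" is the map $X\mapsto V_k(X\otimes\Pi_{k,r})V_k^\dagger$; fresh randomness is drawn from $p_k$. Let $\Pi^+$ be the projector onto the maximally entangled state $|\phi^+\rangle$ of two copies of $M$. In a two-outcome measurement $\{P,\mathbb 1-P\}$ the outcome belonging to $P$ is called $0$. A *QPT adversary* is a family of oracle quantum circuits (over Hadamard, $T$ and CNOT gates, with all qubits initially zero) whose $n$-th member is written down by a Turing machine on input $1^n$ in time polynomial in $n$. **Experiments.** In each of them $k$ is drawn by $\mathsf{KeyGen}(1^n)$. * $\mathsf{QUF\text{-}Forge}(\Pi,\mathcal A,n)$: $\mathcal A$ gets the oracle $\mathsf{Enc}_k$ and outputs a register $C$; the result is $\mathsf{win}$ if $\mathsf{Dec}_k$ of it is not $\bot$, and $\mathsf{reject}$ otherwise. * *Test of a register $C$ against a list of entries $(r,M'')$*: apply $V_k^\dagger$ to $C$, obtaining registers $M'T$. For each entry in turn, measure $\{\Pi_{k,r},\mathbb 1-\Pi_{k,r}\}$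 on $T$; if the outcome is $0$, measure $\{\Pi^+,\mathbb 1-\Pi^+\}$ on $M'M''$; if this outcome is $0$ too, stop: the test *passes at this entry*. If no entry passes, the test *fails*. * $\mathsf{QUF\text{-}Cheat}(\Pi,\mathcal A,n)$: $\mathcal A$ gets an oracle which on input $M$ discards $M$, prepares $|\phi^+\rangle_{M'M''}$, encrypts $M'$ with fresh randomness $r$, returns the ciphertext and stores $(r,M'')$. The final output register $C$ of $\mathcal A$ is tested against the stored entries; the result is $\mathsf{cheat}$ if the test passes and $\mathsf{reject}$ otherwise. * $\mathsf{QAE\text{-}Real}(\Pi,\mathcal A,n)$: $\mathcal A$ gets the oracles $\mathsf{Enc}_k$ and $\mathsf{Dec}_k$ and outputs one of $\mathsf{real}$, $\mathsf{ideal}$. * $\mathsf{QAE\text{-}Ideal}(\Pi,\mathcal A,n)$: $\mathcal A$ gets oracles $E$, $D$ and outputs one of $\mathsf{real}$, $\mathsf{ideal}$. On input $M$, $E$ acts as the oracle of $\mathsf{QUF\text{-}Cheat}$, but stores $(r,M'',M)$, keeping $M$ instead of discarding it. On input $C$, $D$ tests $C$ against the stored entries and returns the register $M$ of the entry at which the test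 passes (the entry is kept, with zeros in place of $M$), or $\bot$ if the test fails. $\Pi$ is $\mathsf{QAE}$ if $\bigl|\Pr[\mathsf{QAE\text{-}Real}(\Pi,\mathcal A,n)\to\mathsf{real}]-\Pr[\mathsf{QAE\text{-}Ideal}(\Pi,\mathcal A,n)\to\mathsf{real}]\bigr|$ is negligible for every QPT adversary $\mathcal A$ with two oracles, and $\mathsf{QUF}$ if $\bigl|\Pr[\mathsf{QUF\text{-}Forge}(\Pi,\mathcal A,n)\to\mathsf{win}]-\Pr[\mathsf{QUF\text{-}Cheat}(\Pi,\mathcal A,n)\to\mathsf{cheat}]\bigr|$ is negligible for every QPT adversary $\mathcal A$ with an encryption oracle only. **Theorem.** Let $\Pi$ be a symmetric-key quantum encryption scheme with a representation as above. 1. If $\Pi$ is $\mathsf{QAE}$, then $\Pi$ is $\mathsf{QUF}$. 2. For every QPT adversary $\mathcal A$ with an encryption oracle only, and $\nu:\mathbb N\to\mathbb R$ with $\Pr[\mathsf{QUF\text{-}Forge}(\Pi,\mathcal A,n)\to\mathsf{win}]=\Pr[\mathsf{QUF\text{-}Cheat}(\Pi,\mathcal A,n)\to\mathsf{cheat}]+\nu(n)$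 for all $n$, there is a QPT adversary $\mathcal B$ with two oracles such that for all $n$ $$\tfrac12\Pr[\mathsf{QAE\text{-}Real}(\Pi,\mathcal B,n)\to\mathsf{real}]-\tfrac12\Pr[\mathsf{QAE\text{-}Ideal}(\Pi,\mathcal B,n)\to\mathsf{real}]=\tfrac{\nu(n)}2,$$ i.e. $\mathcal B$ guesses which of the two equally likely worlds it is in with advantage $\nu(n)/2$ over $1/2$. -/

import Mathlib

open scoped Matrix Kronecker ENNReal ComplexOrder

noncomputable section

namespace QCrypt

/-! ## Registers, operators, channels -/

/-- Labels of the computational basis of a register of `n` qubits. -/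
abbrev Bits (n : ℕ) : Type := Fin n → Bool

/-- The all-zero basis label. -/
def zeros {n : ℕ} : Bits n := fun _ => false

/-- Linear operators on the finite-dimensional Hilbert space with orthonormal basis `A`. -/
abbrev Op (A : Type) : Type := Matrix A A ℂ

/-- `ρ ↦ K ρ K†`. -/
def conj {A B : Type} [Fintype A] (K : Matrix B A ℂ) (ρ : Op A) : Op B := K * ρ * Kᴴ

/-- `K ⊗ 1` applied to a state of a composite system: `ρ ↦ (K ⊗ 1) ρ (K ⊗ 1)†`. -/
def conjLeft {A B S : Type} [Fintype A] [Fintype S] [DecidableEq S]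
    (K : Matrix B A ℂ) (ρ : Op (A × S)) : Op (B × S) :=
  conj (K ⊗ₖ (1 : Matrix S S ℂ)) ρ

/-- `Φ ⊗ id` for a map `Φ` on operators. -/
def ampliate {A B S : Type} (Φ : Op A → Op B) (X : Op (A × S)) : Op (B × S) :=
  Matrix.of fun p q => Φ (Matrix.of fun a a' => X (a, p.2) (a', q.2)) p.1 q.1

/-- Quantum channels: completely positive, trace-preserving maps. -/
structure IsChannel {A B : Type} [Fintype A] [Fintype B] (Φ : Op A →ₗ[ℂ] Op B) : Prop where
  completelyPositive : ∀ (d : ℕ) (X : Op (A × Fin d)), X.PosSemidef → (ampliate Φ X).PosSemidef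
  tracePreserving : ∀ X : Op A, (Φ X).trace = X.trace

/-- The trace norm: the sum of the singular values. -/
def traceNorm {A : Type} [Fintype A] [DecidableEq A] (X : Op A) : ℝ :=
  ∑ i, Real.sqrt ((Matrix.isHermitian_conjTranspose_mul_self X).eigenvalues i)

/-- The diamond norm: the supremum, over all ancilla dimensions, of the trace norm of
`(Φ ⊗ id) X` for `X` of trace norm at most one. -/
def diamondNorm {A B : Type} [Fintype A] [DecidableEq A] [Fintype B] [DecidableEq B]
    (Φ : Op A →ₗ[ℂ] Op B) : ℝ≥0∞ :=
  ⨆ (d : ℕ) (X : Op (A × Fin d)) (_ : traceNorm X ≤ 1), ENNReal.ofReal (traceNorm (ampliate Φ X))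

/-- `1_M ⊕ 0_⊥`: operators on `M`, regarded as operators on `M ⊕ ⊥`. The basis of `M ⊕ ⊥` is
`Option M`, with `none` labelling `⊥`. -/
def withBot (M : Type) : Op M →ₗ[ℂ] Op (Option M) where
  toFun X := Matrix.of fun a b =>
    match a, b with
    | some x, some y => X x y
    | _, _ => 0
  map_add' X Y := by ext (_ | a) (_ | b) <;> simp
  map_smul' z X := by ext (_ | a) (_ | b) <;> simp

/-- The projector onto the maximally entangled state `|φ⁺⟩ = 2^{-m/2} ∑ₓ |x⟩|x⟩`. -/
def phiPlus (m : ℕ) : Op (Bits m × Bits m) :=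
  Matrix.of fun p q => if p.1 = p.2 ∧ q.1 = q.2 then 1 / 2 ^ m else 0

/-! ## Asymptotics -/

/-- Negligible functions of the security parameter. -/
def Negligible (f : ℕ → ℝ) : Prop :=
  Asymptotics.SuperpolynomialDecay Filter.atTop (fun n : ℕ => (n : ℝ)) f

/-- Polynomially bounded lengths. -/
def PolyBounded (f : ℕ → ℕ) : Prop := ∃ p : Polynomial ℕ, ∀ n, f n ≤ p.eval n

/-! ## Symmetric-key quantum encryption -/

/-- A symmetric-key quantum encryption scheme of fixed length: for each security parameter `n`, a
key drawn uniformly from a set of classical keys, encryption channels from `M` to `C` and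
decryption channels from `C` to `M ⊕ ⊥`, correct up to a negligible diamond-norm error. All
registers have polynomially many qubits. (No bound on the running time of the three algorithms
is imposed: every statement about these objects covers in particular the efficient ones.) -/
structure SKQES where
  keyLen : ℕ → ℕ
  msgLen : ℕ → ℕ
  ctxLen : ℕ → ℕ
  keyLen_poly : PolyBounded keyLen
  msgLen_poly : PolyBounded msgLen
  ctxLen_poly : PolyBounded ctxLen
  keys : ∀ n, Finset (Bits (keyLen n))
  keys_nonempty : ∀ n, (keys n).Nonempty
  enc : ∀ n, Bits (keyLen n) → (Op (Bits (msgLen n)) →ₗ[ℂ] Op (Bits (ctxLen n)))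
  dec : ∀ n, Bits (keyLen n) → (Op (Bits (ctxLen n)) →ₗ[ℂ] Op (Option (Bits (msgLen n))))
  enc_channel : ∀ n, ∀ k ∈ keys n, IsChannel (enc n k)
  dec_channel : ∀ n, ∀ k ∈ keys n, IsChannel (dec n k)
  correct : ∃ ε : ℕ → ℝ, Negligible ε ∧ ∀ n, ∀ k ∈ keys n,
    diamondNorm (dec n k ∘ₗ enc n k - withBot (Bits (msgLen n))) ≤ ENNReal.ofReal (ε n)

/-- The data `V`, `p`, `ψ` by which encryption under a fixed key is carried out with explicit
classical randomness `r`: draw `r` from `p`, attach `|ψ r⟩` in a tag register `T` of `t` qubits,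
apply `V`. -/
structure EncData (m c t : ℕ) where
  V : Matrix (Bits c) (Bits m × Bits t) ℂ
  p : Bits t → ℝ
  ψ : Bits t → Bits t → ℂ

/-- The projector `|ψ r⟩⟨ψ r|` on the tag register. -/
def EncData.tagProj {m c t : ℕ} (d : EncData m c t) (r : Bits t) : Op (Bits t) :=
  Matrix.vecMulVec (d.ψ r) (star (d.ψ r))

/-- Encryption with fixed randomness: `X ↦ V (X ⊗ |ψ r⟩⟨ψ r|) V†`. -/
def EncData.encWith {m c t : ℕ} (d : EncData m c t) (r : Bits t) (X : Op (Bits m)) :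
    Op (Bits c) :=
  conj d.V (X ⊗ₖ d.tagProj r)

/-- `d` describes the map `E`: `V` is unitary, `p` is a probability distribution, the `ψ r` form
an orthonormal basis of `T`, and `E X = V (X ⊗ σ) V†` with `σ = ∑ᵣ p r |ψ r⟩⟨ψ r|`. -/
structure EncData.Describes {m c t : ℕ} (d : EncData m c t)
    (E : Op (Bits m) →ₗ[ℂ] Op (Bits c)) : Prop where
  isometry : d.Vᴴ * d.V = 1
  coisometry : d.V * d.Vᴴ = 1
  p_nonneg : ∀ r, 0 ≤ d.p r
  p_sum : ∑ r, d.p r = 1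
  orthonormal : ∀ r r', star (d.ψ r) ⬝ᵥ d.ψ r' = if r = r' then 1 else 0
  enc_eq : ∀ X, E X = conj d.V (X ⊗ₖ ∑ r, (d.p r : ℂ) • d.tagProj r)

/-- A choice, for every security parameter and key, of the data `V_k`, `p_k`, `ψ_{k,r}` describing
the encryption maps of a scheme. The challengers of the cheat-detecting games use this choice. -/
structure SKQES.Representation (S : SKQES) where
  tagLen : ℕ → ℕ
  data : ∀ n, Bits (S.keyLen n) → EncData (S.msgLen n) (S.ctxLen n) (tagLen n)
  describes : ∀ n, ∀ k ∈ S.keys n, (data n k).Describes (S.enc n k)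

/-! ## Oracle circuits

The adversary holds a flag qubit, a plaintext register `M`, a ciphertext register `C` and a work
register. Oracle calls act on the registers `M`, `C` and the flag:
* an encryption call hands over `M` and receives a ciphertext in `C`;
* a decryption call hands over `C` and receives the answer in the flag and `M`, the flag being `1`
  if the answer is a plaintext and `0` if it is `⊥`.

Registers handed over are refilled with zeros, the previous contents of registers in which an
answer is received are discarded. All qubits are zero at the beginning. -/

inductive Wire (m c w : ℕ) : Type where
  | flag : Wire m c w
  | msg : Fin m → Wire m c w
  | ctx : Fin c → Wire m c w
  | work : Fin w → Wire m c w

inductive Gate (m c w : ℕ) : Type where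
  | hadamard : Wire m c w → Gate m c w
  | tgate : Wire m c w → Gate m c w
  | cnot (control target : Wire m c w) : control ≠ target → Gate m c w
  | enc : Gate m c w
  | dec : Gate m c w

/-- A finite alphabet for writing down circuits. -/
inductive Sym : Type where
  | hadamard | tgate | cnot | enc | dec | flag | msg | ctx | work | tick
  deriving DecidableEq

/-- A wire is written as the name of its register and its position in unary. -/
def Wire.code {m c w : ℕ} : Wire m c w → List Sym
  | .flag => [.flag]
  | .msg i => .msg :: List.replicate i .tick
  | .ctx i => .ctx :: List.replicate i .tick
  | .work i => .work :: List.replicate i .tick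

def Gate.code {m c w : ℕ} : Gate m c w → List Sym
  | .hadamard i => .hadamard :: i.code
  | .tgate i => .tgate :: i.code
  | .cnot i j _ => .cnot :: (i.code ++ j.code)
  | .enc => [.enc]
  | .dec => [.dec]

/-- The content of the output stack of a machine that writes a circuit gate by gate, in order of
execution: the symbol written last is on top, i.e. is the head of the list. -/
def circuitCode {m c w : ℕ} (gs : List (Gate m c w)) : List Sym :=
  (gs.flatMap Gate.code).reverse

/-- Quantum polynomial-time oracle algorithms: families of oracle circuits over the gate set
Hadamard, T, CNOT, such that a Turing machine writes down the `n`-th circuit on input `1ⁿ` in time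
polynomial in `n`. -/
structure Adversary (S : SKQES) where
  workLen : ℕ → ℕ
  workLen_poly : PolyBounded workLen
  circuit : ∀ n, List (Gate (S.msgLen n) (S.ctxLen n) (workLen n))
  uniform : Nonempty (Turing.TM2ComputableInPolyTime Computability.unaryEncodeNat
    (id : List Sym → List Sym) (fun n => circuitCode (circuit n)))

/-- The adversary uses no decryption oracle. -/
def Adversary.EncOnly {S : SKQES} (A : Adversary S) : Prop :=
  ∀ n, Gate.dec ∉ A.circuit n

/-- Basis of the adversary's space: flag, `M`, `C`, work register. -/
abbrev Adv (m c w : ℕ) : Type := Bool × Bits m × Bits c × Bits w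

def Adv.get {m c w : ℕ} (s : Adv m c w) : Wire m c w → Bool
  | .flag => s.1
  | .msg i => s.2.1 i
  | .ctx i => s.2.2.1 i
  | .work i => s.2.2.2 i

def Adv.init {m c w : ℕ} : Adv m c w := (false, zeros, zeros, zeros)

def hadamardMatrix : Op Bool :=
  Matrix.of fun a b => (if a && b then -1 else 1) / (Real.sqrt 2 : ℂ)

def tMatrix : Op Bool :=
  Matrix.diagonal fun a => if a then Complex.exp (Complex.I * Real.pi / 4) else 1

open Classical in
/-- The one-qubit operator `g` applied to the wire `i`. -/
def onWire {m c w : ℕ} (g : Op Bool) (i : Wire m c w) : Op (Adv m c w) :=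
  Matrix.of fun s s' =>
    if ∀ l, l ≠ i → Adv.get s l = Adv.get s' l then g (Adv.get s i) (Adv.get s' i) else 0

open Classical in
/-- The permutation operator of CNOT with control `i` and target `j`. -/
def cnotMatrix {m c w : ℕ} (i j : Wire m c w) : Op (Adv m c w) :=
  Matrix.of fun s s' =>
    if (∀ l, l ≠ j → Adv.get s l = Adv.get s' l) ∧
        Adv.get s j = xor (Adv.get s' j) (Adv.get s' i) then 1 else 0

/-! ## The real oracles -/

section Real

variable {m c w : ℕ}

def realEnc (E : Op (Bits m) →ₗ[ℂ] Op (Bits c)) (ρ : Op (Adv m c w)) : Op (Adv m c w) :=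
  Matrix.of fun (f, x, y, z) (f', x', y', z') =>
    if x = zeros ∧ x' = zeros then
      E (Matrix.of fun u u' => ∑ v, ρ (f, u, v, z) (f', u', v, z')) y y'
    else 0

/-- Decryption, followed by the measurement of whether the result is `⊥`. -/
def realDec (D : Op (Bits c) →ₗ[ℂ] Op (Option (Bits m))) (ρ : Op (Adv m c w)) :
    Op (Adv m c w) :=
  Matrix.of fun (f, x, y, z) (f', x', y', z') =>
    let σ := D (Matrix.of fun v v' => ∑ g, ∑ u, ρ (g, u, v, z) (g, u, v', z'))
    if y = zeros ∧ y' = zeros then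
      match f, f' with
      | true, true => σ (some x) (some x')
      | false, false => if x = zeros ∧ x' = zeros then σ none none else 0
      | _, _ => 0
    else 0

def realRun (E : Op (Bits m) →ₗ[ℂ] Op (Bits c)) (D : Op (Bits c) →ₗ[ℂ] Op (Option (Bits m))) :
    List (Gate m c w) → Op (Adv m c w) → Op (Adv m c w)
  | [], ρ => ρ
  | .hadamard i :: gs, ρ => realRun E D gs (conj (onWire hadamardMatrix i) ρ)
  | .tgate i :: gs, ρ => realRun E D gs (conj (onWire tMatrix i) ρ)
  | .cnot i j _ :: gs, ρ => realRun E D gs (conj (cnotMatrix i j) ρ)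
  | .enc :: gs, ρ => realRun E D gs (realEnc E ρ)
  | .dec :: gs, ρ => realRun E D gs (realDec D ρ)

/-- The reduced state of the register `C`. -/
def ctxState (ρ : Op (Adv m c w)) : Op (Bits c) :=
  Matrix.of fun y y' => ∑ f, ∑ x, ∑ z, ρ (f, x, y, z) (f, x, y', z)

end Real

/-! ## The cheat-detecting challenger

After `q` encryption calls, in which the randomness `r 0, …, r (q - 1)` was used, the challenger
holds the reference halves `M''` of `q` maximally entangled pairs, a register with basis
`Fin q → Bits m`, and possibly further registers, with basis `E`. -/

section Ideal

variable {m c t w q : ℕ}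

/-- `Enc` with randomness `r`, applied to the first half of a maximally entangled pair. -/
def encHalf (d : EncData m c t) (r : Bits t) : Op (Bits c × Bits m) :=
  ampliate (d.encWith r) (phiPlus m)

/-- Basis of the registers tested by the challenger: the decoded registers `M` and `T`, and all
the reference halves. -/
abbrev Tested (m t q : ℕ) : Type := (Bits m × Bits t) × (Fin q → Bits m)

/-- `Π_{k,r}` on `T`. -/
def tagTest (d : EncData m c t) (r : Bits t) : Op (Tested m t q) :=
  Matrix.of fun ((x, s), a) ((x', s'), a') => if x = x' ∧ a = a' then d.tagProj r s s' else 0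

/-- `Π⁺` on `M` and the `i`-th reference half. -/
def entTest (i : Fin q) : Op (Tested m t q) :=
  Matrix.of fun ((x, s), a) ((x', s'), a') =>
    if s = s' ∧ ∀ j, j ≠ i → a j = a' j then phiPlus m (x, a i) (x', a' i) else 0

/-- `V†` is applied to the register `C`, giving `M` and `T`; the remaining registers are only
rearranged. -/
def undoV {E : Type} (d : EncData m c t)
    (ρ : Op (Adv m c w × (Fin q → Bits m) × E)) :
    Op (Tested m t q × (Bool × Bits m × Bits w) × E) :=
  Matrix.of fun ((u, a), (f, x, z), e) ((u', a'), (f', x', z'), e') =>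
    conj d.Vᴴ (Matrix.of fun y y' => ρ ((f, x, y, z), a, e) ((f', x', y', z'), a', e')) u u'

/-- The sequence of tests on a list of entries of the challenger's memory. On the entry `i`, the
measurement `{Π_{k,r i}, 1 - Π_{k,r i}}` is applied to `T`; if its outcome is `0`, the measurement
`{Π⁺, 1 - Π⁺}` is applied to `M` and the `i`-th reference half; if its outcome is `0` too, the
procedure ends with the result `accept i`. In all other cases it goes on with the next entry, and
ends with the result `reject` after the last one. States are not normalized: the results of all
branches add up. -/
def testLoop {R β : Type} [Add β] [Fintype R] [DecidableEq R] (d : EncData m c t)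
    (r : Fin q → Bits t) (accept : Fin q → Op (Tested m t q × R) → β)
    (reject : Op (Tested m t q × R) → β) :
    List (Fin q) → Op (Tested m t q × R) → β
  | [], σ => reject σ
  | i :: is, σ =>
    accept i (conjLeft (entTest i * tagTest d (r i)) σ) +
      testLoop d r accept reject is
        (conjLeft (1 - tagTest d (r i)) σ + conjLeft ((1 - entTest i) * tagTest d (r i)) σ)

/-! ### The game with a final test -/

/-- An encryption call: `M` is discarded, half of a maximally entangled pair is encrypted with
randomness `r`, the other half is stored. -/
def cheatEnc (d : EncData m c t) (r : Bits t) (ρ : Op (Adv m c w × (Fin q → Bits m) × Unit)) :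
    Op (Adv m c w × (Fin (q + 1) → Bits m) × Unit) :=
  Matrix.of fun ((f, x, y, z), a, _) ((f', x', y', z'), a', _) =>
    if x = zeros ∧ x' = zeros then
      (∑ u, ∑ v, ρ ((f, u, v, z), Fin.init a, ()) ((f', u, v, z'), Fin.init a', ())) *
        encHalf d r (y, a (Fin.last q)) (y', a' (Fin.last q))
    else 0

/-- Probability of the outcome `cheat`, after the remaining gates are executed and the final
content of `C` is tested. Adversaries in this game have no decryption oracle; the corresponding
gate is skipped. -/
def cheatRun (d : EncData m c t) : List (Gate m c w) → (q : ℕ) → (Fin q → Bits t) →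
    Op (Adv m c w × (Fin q → Bits m) × Unit) → ℝ
  | [], q, r, ρ =>
    testLoop d r (fun _ σ => σ.trace.re) (fun _ => 0) (List.finRange q) (undoV d ρ)
  | .hadamard i :: gs, q, r, ρ => cheatRun d gs q r (conjLeft (onWire hadamardMatrix i) ρ)
  | .tgate i :: gs, q, r, ρ => cheatRun d gs q r (conjLeft (onWire tMatrix i) ρ)
  | .cnot i j _ :: gs, q, r, ρ => cheatRun d gs q r (conjLeft (cnotMatrix i j) ρ)
  | .enc :: gs, q, r, ρ =>
    ∑ r₀, d.p r₀ * cheatRun d gs (q + 1) (Fin.snoc (α := fun _ => Bits t) r r₀) (cheatEnc d r₀ ρ)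
  | .dec :: gs, q, r, ρ => cheatRun d gs q r ρ

/-! ### The ideal world: the plaintexts are stored as well (`E = Fin q → Bits m`) -/

/-- An encryption call: `M` is stored, half of a maximally entangled pair is encrypted with
randomness `r`, the other half is stored. -/
def idealEnc (d : EncData m c t) (r : Bits t)
    (ρ : Op (Adv m c w × (Fin q → Bits m) × (Fin q → Bits m))) :
    Op (Adv m c w × (Fin (q + 1) → Bits m) × (Fin (q + 1) → Bits m)) :=
  Matrix.of fun ((f, x, y, z), a, b) ((f', x', y', z'), a', b') =>
    if x = zeros ∧ x' = zeros then
      (∑ v, ρ ((f, b (Fin.last q), v, z), Fin.init a, Fin.init b)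
        ((f', b' (Fin.last q), v, z'), Fin.init a', Fin.init b')) *
        encHalf d r (y, a (Fin.last q)) (y', a' (Fin.last q))
    else 0

/-- The answer to a decryption call that passed the test on the entry `i`: the `i`-th stored
plaintext is moved to the adversary's register `M` (zeros are left in its place), and the flag is
set; the decoded registers are discarded. -/
def idealAccept (i : Fin q)
    (σ : Op (Tested m t q × (Bool × Bits m × Bits w) × (Fin q → Bits m))) :
    Op (Adv m c w × (Fin q → Bits m) × (Fin q → Bits m)) :=
  Matrix.of fun ((f, x, y, z), a, b) ((f', x', y', z'), a', b') =>
    if (f = true ∧ f' = true) ∧ (y = zeros ∧ y' = zeros) ∧ (b i = zeros ∧ b' i = zeros) then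
      ∑ u, ∑ g, ∑ v, σ ((u, a), (g, v, z), Function.update b i x)
        ((u, a'), (g, v, z'), Function.update b' i x')
    else 0

/-- The answer `⊥` to a decryption call. -/
def idealReject (σ : Op (Tested m t q × (Bool × Bits m × Bits w) × (Fin q → Bits m))) :
    Op (Adv m c w × (Fin q → Bits m) × (Fin q → Bits m)) :=
  Matrix.of fun ((f, x, y, z), a, b) ((f', x', y', z'), a', b') =>
    if (f = false ∧ f' = false) ∧ (x = zeros ∧ x' = zeros) ∧ (y = zeros ∧ y' = zeros) then
      ∑ u, ∑ g, ∑ v, σ ((u, a), (g, v, z), b) ((u, a'), (g, v, z'), b')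
    else 0

def idealDec (d : EncData m c t) (r : Fin q → Bits t)
    (ρ : Op (Adv m c w × (Fin q → Bits m) × (Fin q → Bits m))) :
    Op (Adv m c w × (Fin q → Bits m) × (Fin q → Bits m)) :=
  testLoop d r idealAccept idealReject (List.finRange q) (undoV d ρ)

/-- Probability that the flag is measured to be `1` after the remaining gates are executed. -/
def idealRun (d : EncData m c t) : List (Gate m c w) → (q : ℕ) → (Fin q → Bits t) →
    Op (Adv m c w × (Fin q → Bits m) × (Fin q → Bits m)) → ℝ
  | [], _, _, ρ => ∑ s, if s.1.1 = true then (ρ s s).re else 0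
  | .hadamard i :: gs, q, r, ρ => idealRun d gs q r (conjLeft (onWire hadamardMatrix i) ρ)
  | .tgate i :: gs, q, r, ρ => idealRun d gs q r (conjLeft (onWire tMatrix i) ρ)
  | .cnot i j _ :: gs, q, r, ρ => idealRun d gs q r (conjLeft (cnotMatrix i j) ρ)
  | .enc :: gs, q, r, ρ =>
    ∑ r₀, d.p r₀ * idealRun d gs (q + 1) (Fin.snoc (α := fun _ => Bits t) r r₀) (idealEnc d r₀ ρ)
  | .dec :: gs, q, r, ρ => idealRun d gs q r (idealDec d r ρ)

end Ideal

/-! ## The experiments -/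

namespace SKQES

variable (S : SKQES)

/-- Average over a uniformly random key. -/
def keyAverage (n : ℕ) (f : Bits (S.keyLen n) → ℝ) : ℝ :=
  (∑ k ∈ S.keys n, f k) / (S.keys n).card

open Classical in
/-- The basis state `|s⟩⟨s|`. -/
def pureBasis {A : Type} (s : A) : Op A := Matrix.of fun a b => if a = s ∧ b = s then 1 else 0

/-- `Pr[QUF-Forge → win]`: the adversary outputs its register `C`, which decrypts to a
plaintext. -/
def probForge (A : Adversary S) (n : ℕ) : ℝ :=
  S.keyAverage n fun k =>
    ∑ x, (S.dec n k (ctxState (realRun (S.enc n k) (S.dec n k) (A.circuit n)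
      (pureBasis Adv.init))) (some x) (some x)).re

/-- `Pr[QUF-Cheat → cheat]`. -/
def probCheat (R : S.Representation) (A : Adversary S) (n : ℕ) : ℝ :=
  S.keyAverage n fun k =>
    cheatRun (R.data n k) (A.circuit n) 0 Fin.elim0 (pureBasis (Adv.init, Fin.elim0, ()))

/-- `Pr[QAE-Real → real]`: the adversary outputs its flag qubit, `1` meaning `real`. -/
def probReal (A : Adversary S) (n : ℕ) : ℝ :=
  S.keyAverage n fun k =>
    ∑ s, if s.1 = true then
      (realRun (S.enc n k) (S.dec n k) (A.circuit n) (pureBasis Adv.init) s s).re else 0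

/-- `Pr[QAE-Ideal → real]`. -/
def probIdeal (R : S.Representation) (A : Adversary S) (n : ℕ) : ℝ :=
  S.keyAverage n fun k =>
    idealRun (R.data n k) (A.circuit n) 0 Fin.elim0 (pureBasis (Adv.init, Fin.elim0, Fin.elim0))

/-- Quantum authenticated encryption. -/
def IsQAE (R : S.Representation) : Prop :=
  ∀ A : Adversary S, Negligible fun n => |S.probReal A n - S.probIdeal R A n|

/-- Quantum unforgeability. -/
def IsQUF (R : S.Representation) : Prop :=
  ∀ A : Adversary S, A.EncOnly → Negligible fun n => |S.probForge A n - S.probCheat R A n|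

end SKQES

end QCrypt

end

/-!
A forger `A` becomes a distinguisher by making one decryption call on its output `C` and answering
with the flag. In the real world the flag is `1` exactly when `C` is not decrypted to `⊥`, so the
distinguisher says `real` as often as `A` wins the forging game. In the ideal world the final call
runs the test of the cheating game. The two games differ only in that the ideal challenger keeps the
plaintexts handed over by `A`; before that last call nothing depends on them, so they may be traced
out, and this turns every state of the ideal world into the corresponding state of the cheating
game. On the side of the machines, a circuit is written in order of execution, so appending a gate
amounts to one more push when the machine writing the circuit is about to halt.
-/

noncomputable section

namespace QCrypt

section RunAtHalt

open Turing StateTransition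

theorem iterate_bind_map {α β : Type*} {f : α → Option α} {g : β → Option β} (φ : α → β)
    (hφ : ∀ a b, f a = some b → g (φ a) = some (φ b)) {a b : α} {n : ℕ}
    (h : (flip bind f)^[n] (some a) = some b) :
    (flip bind g)^[n] (some (φ a)) = some (φ b) := by
  induction n generalizing b with
  | zero => exact congrArg (Option.map φ) h
  | succ n ih =>
    rw [Function.iterate_succ_apply'] at h ⊢
    obtain ⟨a', ha', hstep⟩ := Option.bind_eq_some_iff.1 h
    rw [ih ha']
    exact hφ a' b hstep

/-- A simulation of `f` by `g` that matches single steps preserves running times. -/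
def evalsToInTimeMap {α β : Type*} {f : α → Option α} {g : β → Option β} (φ : α → β)
    (hφ : ∀ a b, f a = some b → g (φ a) = some (φ b)) {a b : α} {m : ℕ}
    (h : EvalsToInTime f a (some b) m) : EvalsToInTime g (φ a) (some (φ b)) m where
  steps := h.steps
  evals_in_steps := iterate_bind_map φ hφ h.evals_in_steps
  steps_le_m := h.steps_le_m

variable {K Λ σ : Type*} {Γ : K → Type*}

/-- The statement that runs `e` wherever the given statement would halt. -/
def replaceHalt (e : TM2.Stmt Γ Λ σ) : TM2.Stmt Γ Λ σ → TM2.Stmt Γ Λ σ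
  | .push k f s => .push k f (replaceHalt e s)
  | .peek k f s => .peek k f (replaceHalt e s)
  | .pop k f s => .pop k f (replaceHalt e s)
  | .load f s => .load f (replaceHalt e s)
  | .branch p s₁ s₂ => .branch p (replaceHalt e s₁) (replaceHalt e s₂)
  | .goto l => .goto l
  | .halt => e

variable [DecidableEq K]

/-- The result of running `e` in a configuration that has halted; the other configurations are
left alone. -/
def continueHalted (e : TM2.Stmt Γ Λ σ) : TM2.Cfg Γ Λ σ → TM2.Cfg Γ Λ σ
  | ⟨none, v, T⟩ => TM2.stepAux e v T
  | ⟨some l, v, T⟩ => ⟨some l, v, T⟩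

theorem stepAux_replaceHalt (e s : TM2.Stmt Γ Λ σ) (v : σ) (T : ∀ k, List (Γ k)) :
    TM2.stepAux (replaceHalt e s) v T = continueHalted e (TM2.stepAux s v T) := by
  induction s generalizing v T with
  | branch p s₁ s₂ ih₁ ih₂ =>
    simp only [replaceHalt, TM2.stepAux, ih₁, ih₂]
    cases p v <;> rfl
  | goto | halt => rfl
  | _ => simp_all only [replaceHalt, TM2.stepAux]

theorem step_replaceHalt (e : TM2.Stmt Γ Λ σ) (M : Λ → TM2.Stmt Γ Λ σ) (a b : TM2.Cfg Γ Λ σ)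
    (h : TM2.step M a = some b) :
    TM2.step (fun l => replaceHalt e (M l)) (continueHalted e a) = some (continueHalted e b) := by
  obtain ⟨_ | l, v, T⟩ := a
  · cases h
  · obtain rfl : TM2.stepAux (M l) v T = b := Option.some.inj h
    exact congrArg some (stepAux_replaceHalt e (M l) v T)

/-- The machine that, when `tm` would halt, first writes `g` on the output stack. -/
def pushAtHalt (tm : FinTM2) (g : tm.Γ tm.k₁) : FinTM2 :=
  { tm with m := fun l => replaceHalt (.push tm.k₁ (fun _ => g) .halt) (tm.m l) }

theorem continueHalted_push_haltList (tm : FinTM2) (g : tm.Γ tm.k₁) (l : List (tm.Γ tm.k₁)) :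
    continueHalted (.push tm.k₁ (fun _ => g) .halt) (haltList tm l) = haltList tm (g :: l) := by
  refine congrArg (TM2.Cfg.mk none tm.initialState) (funext fun k => ?_)
  obtain rfl | hk := eq_or_ne k tm.k₁
  · simp
  · simp [hk]

/-- Writing a fixed symbol on top of the output preserves computability in polynomial time. -/
def polyTimeConsOutput {α β γ αΓ Δ : Type} {ea : α → List αΓ} {eb : β → List Δ} {ec : γ → List Δ}
    {f : α → β} {f' : α → γ} (h : TM2ComputableInPolyTime ea eb f) (b : Δ)
    (hf' : ∀ a, ec (f' a) = b :: eb (f a)) : TM2ComputableInPolyTime ea ec f' where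
  tm := pushAtHalt h.tm (h.outputAlphabet.symm b)
  inputAlphabet := h.inputAlphabet
  outputAlphabet := h.outputAlphabet
  time := h.time
  outputsFun a := by
    have run := evalsToInTimeMap _
      (step_replaceHalt (.push h.tm.k₁ (fun _ => h.outputAlphabet.symm b) .halt) h.tm.m)
      (h.outputsFun a)
    rw [continueHalted_push_haltList] at run
    rw [hf']
    exact run

end RunAtHalt

theorem circuitCode_append {m c w : ℕ} (gs hs : List (Gate m c w)) :
    circuitCode (gs ++ hs) = circuitCode hs ++ circuitCode gs := by
  simp only [circuitCode, List.flatMap_append, List.reverse_append]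

/-- The adversary that runs `A` and then decrypts the register `C`, so that its flag tells whether
the output of `A` is accepted. -/
def Adversary.thenDec {S : SKQES} (A : Adversary S) : Adversary S where
  workLen := A.workLen
  workLen_poly := A.workLen_poly
  circuit n := A.circuit n ++ [.dec]
  uniform := by
    obtain ⟨machine⟩ := A.uniform
    exact ⟨polyTimeConsOutput machine .dec fun n => circuitCode_append (A.circuit n) [.dec]⟩

/-- The probability that a measurement of `ρ` in the computational basis gives a label whose flag
is `1`. -/
def flagProb {A : Type} [Fintype A] (flag : A → Bool) : Op A →+ ℝ where
  toFun ρ := ∑ s, if flag s = true then (ρ s s).re else 0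
  map_zero' := by simp
  map_add' ρ σ := by
    rw [← Finset.sum_add_distrib]
    refine Finset.sum_congr rfl fun s _ => ?_
    split_ifs <;> simp

theorem flagProb_apply {A : Type} [Fintype A] (flag : A → Bool) (ρ : Op A) :
    flagProb flag ρ = ∑ s, if flag s = true then (ρ s s).re else 0 :=
  rfl

section Real

variable {m c w : ℕ}

theorem realRun_append (E : Op (Bits m) →ₗ[ℂ] Op (Bits c))
    (D : Op (Bits c) →ₗ[ℂ] Op (Option (Bits m))) (gs hs : List (Gate m c w))
    (ρ : Op (Adv m c w)) :
    realRun E D (gs ++ hs) ρ = realRun E D hs (realRun E D gs ρ) := by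
  induction gs generalizing ρ with
  | nil => rfl
  | cons g gs ih => cases g <;> exact ih _

theorem ctxState_eq_sum (ρ : Op (Adv m c w)) :
    ctxState ρ =
      ∑ z, (Matrix.of fun v v' => ∑ g, ∑ u, ρ (g, u, v, z) (g, u, v', z) : Op (Bits c)) := by
  ext y y'
  simp only [ctxState, Matrix.of_apply, Matrix.sum_apply]
  rw [Finset.sum_comm_cycle]

theorem flagProb_realDec (D : Op (Bits c) →ₗ[ℂ] Op (Option (Bits m))) (ρ : Op (Adv m c w)) :
    flagProb (fun s => s.1) (realDec D ρ) = ∑ x, (D (ctxState ρ) (some x) (some x)).re := by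
  simp only [flagProb_apply, Fintype.sum_prod_type, Fintype.sum_bool, realDec, Matrix.of_apply,
    if_true, and_self, Bool.false_eq_true, if_false, Finset.sum_const_zero, add_zero,
    apply_ite Complex.re, Complex.zero_re]
  -- `realDec` applies `D` separately for each basis state of the work register.
  rw [ctxState_eq_sum, map_sum]
  refine Finset.sum_congr rfl fun x _ => ?_
  rw [Finset.sum_comm]
  simp only [Finset.sum_ite_eq', Finset.mem_univ, if_true, Matrix.sum_apply, Complex.re_sum,
    Fintype.sum_bool]

end Real

section PartialTrace

variable {A B S E : Type}

theorem conj_apply [Fintype A] (K : Matrix B A ℂ) (ρ : Op A) (i j : B) :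
    conj K ρ i j = ∑ b, ∑ a, K i a * ρ a b * star (K j b) := by
  simp only [conj, Matrix.mul_apply, Matrix.conjTranspose_apply, Finset.sum_mul]

theorem conjLeft_apply [Fintype A] [Fintype S] [DecidableEq S] (K : Matrix B A ℂ)
    (ρ : Op (A × S)) (p q : B × S) :
    conjLeft K ρ p q = ∑ b, ∑ a, K p.1 a * ρ (a, p.2) (b, q.2) * star (K q.1 b) := by
  simp [conjLeft, conj_apply, Fintype.sum_prod_type, Matrix.one_apply, apply_ite]

variable [Fintype E]

/-- The partial trace over the last register. A trivial register takes its place, because the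
challenger's states always have a third register. -/
def traceLast : Op (A × S × E) →ₗ[ℂ] Op (A × S × Unit) where
  toFun ρ := Matrix.of fun p q => ∑ e, ρ (p.1, p.2.1, e) (q.1, q.2.1, e)
  map_add' ρ σ := by ext p q; simp [Finset.sum_add_distrib]
  map_smul' z ρ := by ext p q; simp [Finset.mul_sum]

theorem traceLast_apply (ρ : Op (A × S × E)) (p q : A × S × Unit) :
    traceLast ρ p q = ∑ e, ρ (p.1, p.2.1, e) (q.1, q.2.1, e) :=
  rfl

theorem trace_traceLast [Fintype A] [Fintype S] (ρ : Op (A × S × E)) :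
    (traceLast ρ).trace = ρ.trace := by
  simp [Matrix.trace, traceLast_apply, Fintype.sum_prod_type]

theorem traceLast_conjLeft [Fintype A] [Fintype S] [DecidableEq S] [DecidableEq E]
    (K : Matrix B A ℂ) (ρ : Op (A × S × E)) :
    traceLast (conjLeft K ρ) = conjLeft K (traceLast ρ) := by
  ext p q
  simp only [traceLast_apply, conjLeft_apply, Finset.mul_sum, Finset.sum_mul]
  exact Finset.sum_comm_cycle.symm

theorem traceLast_pureBasis (a : A) (s : S) (e : E) :
    traceLast (SKQES.pureBasis (a, s, e)) = SKQES.pureBasis (a, s, ()) := by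
  ext ⟨a₁, s₁, _⟩ ⟨a₂, s₂, _⟩
  simp only [traceLast_apply, SKQES.pureBasis, Matrix.of_apply]
  rw [Finset.sum_eq_single e (fun e' _ he => by simp [he]) (by simp)]
  classical simp only [Prod.mk.injEq, and_true]

end PartialTrace

section Ideal

variable {m c t w q : ℕ}

theorem traceLast_undoV {E : Type} [Fintype E] (d : EncData m c t)
    (ρ : Op (Adv m c w × (Fin q → Bits m) × E)) :
    traceLast (undoV d ρ) = undoV d (traceLast ρ) := by
  ext p q
  simp only [traceLast_apply, undoV, conj_apply, Matrix.of_apply, Finset.mul_sum, Finset.sum_mul]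
  exact Finset.sum_comm_cycle.symm

theorem sum_pi_eq_sum_sum_snoc {n : ℕ} {α : Fin (n + 1) → Type*} {M : Type*} [∀ i, Fintype (α i)]
    [AddCommMonoid M] (F : (∀ i, α i) → M) :
    ∑ b, F b = ∑ x, ∑ b : ∀ i : Fin n, α i.castSucc, F (Fin.snoc b x) := by
  rw [← (Fin.snocEquiv α).sum_comp, Fintype.sum_prod_type]
  rfl

theorem traceLast_idealEnc (d : EncData m c t) (r : Bits t)
    (ρ : Op (Adv m c w × (Fin q → Bits m) × (Fin q → Bits m))) :
    traceLast (idealEnc d r ρ) = cheatEnc d r (traceLast ρ) := by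
  ext ⟨⟨f, x, y, z⟩, a, _⟩ ⟨⟨f', x', y', z'⟩, a', _⟩
  simp only [traceLast_apply, idealEnc, cheatEnc, Matrix.of_apply]
  split_ifs
  · simp only [← Finset.sum_mul, sum_pi_eq_sum_sum_snoc, Fin.init_snoc, Fin.snoc_last]
    congr 1
    exact Finset.sum_congr rfl fun _ _ => Finset.sum_comm
  · exact Finset.sum_const_zero

theorem map_testLoop {R β γ F : Type} [Fintype R] [DecidableEq R] [Add β] [Add γ]
    [FunLike F β γ] [AddHomClass F β γ] (φ : F) (d : EncData m c t) (r : Fin q → Bits t)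
    (accept : Fin q → Op (Tested m t q × R) → β) (reject : Op (Tested m t q × R) → β)
    (is : List (Fin q)) (σ : Op (Tested m t q × R)) :
    φ (testLoop d r accept reject is σ) =
      testLoop d r (fun i τ => φ (accept i τ)) (fun τ => φ (reject τ)) is σ := by
  induction is generalizing σ with
  | nil => rfl
  | cons i is ih => simp only [testLoop, map_add, ih]

theorem testLoop_traceLast {S E β : Type} [Fintype S] [DecidableEq S] [Fintype E] [DecidableEq E]
    [Add β] (d : EncData m c t) (r : Fin q → Bits t)
    (accept : Fin q → Op (Tested m t q × S × Unit) → β)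
    (reject : Op (Tested m t q × S × Unit) → β) (is : List (Fin q))
    (σ : Op (Tested m t q × S × E)) :
    testLoop d r accept reject is (traceLast σ) =
      testLoop d r (fun i τ => accept i (traceLast τ)) (fun τ => reject (traceLast τ)) is σ := by
  induction is generalizing σ with
  | nil => rfl
  | cons i is ih => simp only [testLoop, ← traceLast_conjLeft, ← map_add, ih]

theorem sum_sum_ite_update {ι α M : Type*} [Fintype ι] [DecidableEq ι] [Fintype α]
    [DecidableEq α] [AddCommMonoid M] (i : ι) (o : α) (F : (ι → α) → M) :
    (∑ x, ∑ b, if b i = o then F (Function.update b i x) else 0) = ∑ b, F b := by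
  rw [← Fintype.sum_prod_type', ← Finset.sum_filter]
  refine Finset.sum_bij' (fun p _ => Function.update p.2 i p.1)
    (fun b _ => (b i, Function.update b i o)) ?_ ?_ ?_ ?_ ?_
  · simp
  · simp
  · rintro ⟨x, b⟩ hb
    obtain rfl : b i = o := by simpa using hb
    simp
  · simp
  · simp

theorem flagProb_idealReject
    (σ : Op (Tested m t q × (Bool × Bits m × Bits w) × (Fin q → Bits m))) :
    flagProb (fun s => s.1.1) (idealReject (c := c) σ) = 0 := by
  refine Finset.sum_eq_zero fun s _ => ?_
  obtain ⟨⟨_ | _, x, y, z⟩, a, b⟩ := s <;> simp [idealReject]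

theorem trace_eq_sum_kept_sum_discarded {E : Type} [Fintype E]
    (σ : Op (Tested m t q × (Bool × Bits m × Bits w) × E)) :
    σ.trace = ∑ z, ∑ a, ∑ b, ∑ u, ∑ g, ∑ v, σ ((u, a), (g, v, z), b) ((u, a), (g, v, z), b) := by
  let e : (Bits w × (Fin q → Bits m) × E) × (Bits m × Bits t) × Bool × Bits m ≃
      Tested m t q × (Bool × Bits m × Bits w) × E :=
    { toFun := fun ((z, a, b), u, g, v) => ((u, a), (g, v, z), b)
      invFun := fun ((u, a), (g, v, z), b) => ((z, a, b), u, g, v) }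
  rw [Matrix.trace, ← e.sum_comp]
  simp only [Fintype.sum_prod_type, Matrix.diag_apply, e, Equiv.coe_fn_mk]

theorem flagProb_idealAccept (i : Fin q)
    (σ : Op (Tested m t q × (Bool × Bits m × Bits w) × (Fin q → Bits m))) :
    flagProb (fun s => s.1.1) (idealAccept (c := c) i σ) = σ.trace.re := by
  set τ : Bits w → (Fin q → Bits m) → (Fin q → Bits m) → ℂ := fun z a b =>
    ∑ u, ∑ g, ∑ v, σ ((u, a), (g, v, z), b) ((u, a), (g, v, z), b) with hτ
  calc
    flagProb (fun s => s.1.1) (idealAccept (c := c) i σ)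
    _ = ∑ x, ∑ y : Bits c, ∑ z, ∑ a, ∑ b, if y = zeros then if b i = zeros then
          (τ z a (Function.update b i x)).re else 0 else 0 := by
      simp only [flagProb_apply, Fintype.sum_prod_type, Fintype.sum_bool, idealAccept,
        Matrix.of_apply, true_and, and_self, if_true, Bool.false_eq_true, if_false,
        Finset.sum_const_zero, add_zero, apply_ite Complex.re, Complex.zero_re]
      simp only [hτ, Fintype.sum_prod_type, Fintype.sum_bool, ite_and]
    _ = ∑ x, ∑ z, ∑ a, ∑ b, if b i = zeros then (τ z a (Function.update b i x)).re else 0 :=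
      Finset.sum_congr rfl fun x _ => by
        rw [Finset.sum_eq_single zeros (fun y _ hy => by simp [hy]) (by simp)]
        simp only [if_true]
    _ = ∑ z, ∑ a, ∑ x, ∑ b, if b i = zeros then (τ z a (Function.update b i x)).re else 0 := by
      rw [Finset.sum_comm]
      exact Finset.sum_congr rfl fun _ _ => Finset.sum_comm
    -- Zeros are left in place of the returned plaintext, so the answer together with the remaining
    -- plaintexts determines the stored ones, and conversely.
    _ = (∑ z, ∑ a, ∑ b, τ z a b).re := by
      simp only [Complex.re_sum, fun z a => sum_sum_ite_update i zeros fun b => (τ z a b).re]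
    _ = σ.trace.re := by rw [trace_eq_sum_kept_sum_discarded]

theorem flagProb_idealDec (d : EncData m c t) (r : Fin q → Bits t)
    (ρ : Op (Adv m c w × (Fin q → Bits m) × (Fin q → Bits m))) :
    flagProb (fun s => s.1.1) (idealDec d r ρ) = cheatRun d [] q r (traceLast ρ) := by
  rw [idealDec, cheatRun, map_testLoop, ← traceLast_undoV, testLoop_traceLast]
  simp only [flagProb_idealAccept, flagProb_idealReject, trace_traceLast]

theorem idealRun_append_dec (d : EncData m c t) {gs : List (Gate m c w)} (hgs : Gate.dec ∉ gs)
    (r : Fin q → Bits t) (ρ : Op (Adv m c w × (Fin q → Bits m) × (Fin q → Bits m))) :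
    idealRun d (gs ++ [.dec]) q r ρ = cheatRun d gs q r (traceLast ρ) := by
  induction gs generalizing q with
  | nil => exact flagProb_idealDec d r ρ
  | cons g gs ih =>
    rw [List.mem_cons, not_or] at hgs
    cases g with
    | dec => exact absurd rfl hgs.1
    | enc => simp only [List.cons_append, idealRun, cheatRun, ih hgs.2, traceLast_idealEnc]
    | _ => simp only [List.cons_append, idealRun, cheatRun, ih hgs.2, traceLast_conjLeft]

end Ideal

namespace SKQES

variable {S : SKQES}

theorem probReal_thenDec (A : Adversary S) (n : ℕ) :
    S.probReal A.thenDec n = S.probForge A n := by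
  refine congrArg (S.keyAverage n) (funext fun k => ?_)
  rw [← flagProb_realDec]
  exact congrArg (flagProb _) (realRun_append _ _ (A.circuit n) [.dec] _)

theorem probIdeal_thenDec (R : S.Representation) {A : Adversary S} (hA : A.EncOnly) (n : ℕ) :
    S.probIdeal R A.thenDec n = S.probCheat R A n := by
  refine congrArg (S.keyAverage n) (funext fun k => ?_)
  rw [← traceLast_pureBasis Adv.init Fin.elim0 (Fin.elim0 : Fin 0 → Bits (S.msgLen n))]
  exact idealRun_append_dec _ (hA n) _ _

end SKQES

end QCrypt

end

theorem mainTheorem4 (S : QCrypt.SKQES) (R : S.Representation) :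
    (S.IsQAE R → S.IsQUF R) ∧
    ∀ (A : QCrypt.Adversary S), A.EncOnly → ∀ ν : ℕ → ℝ,
      (∀ n, S.probForge A n = S.probCheat R A n + ν n) →
      ∃ B : QCrypt.Adversary S, ∀ n,
        1 / 2 * S.probReal B n - 1 / 2 * S.probIdeal R B n = ν n / 2 := by
  refine ⟨fun hQAE A hA => ?_, fun A hA ν hν => ⟨A.thenDec, fun n => ?_⟩⟩
  · simpa only [QCrypt.SKQES.probReal_thenDec, QCrypt.SKQES.probIdeal_thenDec R hA]
      using hQAE A.thenDec
  · rw [QCrypt.SKQES.probReal_thenDec, QCrypt.SKQES.probIdeal_thenDec R hA, hν]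
    ring
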